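/- Let $\mathbb{A}$ be the field of algebraic complex numbers. For $k\ge 0$ let $\Upsilon_k$ be the set of all functions $\{0,1\}^k\to\mathbb{A}$, let $\Upsilon=\bigcup_{k\ge 0}\Upsilon_k$, and let $\mathcal{U}=\Upsilon_1$ be the set of all unary functions. A function $f\in\Upsilon_{2n}$ is unitary if for all $\mathbf{x},\mathbf{y}\in\{0,1\}^n$ the sum $\sum_{\mathbf{z}\in\{0,1\}^n}\overline{f(\mathbf{x},\mathbf{z})}\,f(\mathbf{y},\mathbf{z})$ equals $1$ if $\mathbf{x}=\mathbf{y}$ and $0$ otherwise. Let $\mathcal{S}$ be the set of all unitary functions in $\Upsilon_2$ (the single-qubit gates), and let $\mathrm{CNOT}\in\Upsilon_4$ be the function that is $1$ on the inputs $0000,0101,1011,1110$ and $0$ on all other inputs. For $\mathcal{F}\subseteq\Upsilon$, the holant clone $\langle\mathcal{F}\rangle_h$ generated by $\mathcal{F}$ is the set of all functions $f\in\Upsilon$, of any arity $n\ge 0$, of the form $$f(x_1,\ldots,x_n)=\sum_{x_{n+1},\ldots,x_{n+m}\in\{0,1\}}\ \prod_{j=1}^{s} g_j\bigl(x_{i_{j,1}},\ldots,x_{i_{j,k_j}}\bigr),$$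 where $m,s\ge 0$, each $g_j\in\mathcal{F}$ has arity $k_j$, all indices $i_{j,\ell}$ lie in $\{1,\ldots,n+m\}$, and among all the indices $i_{j,\ell}$ (counted with multiplicity) each of $1,\ldots,n$ occurs exactly once and each of $n+1,\ldots,n+m$ occurs exactly twice. Then every algebraic-complex-valued function of Boolean variables lies in the holant clone generated by the unary functions, the single-qubit gates and $\mathrm{CNOT}$: $$\Upsilon\subseteq\langle\,\mathcal{U}\cup\mathcal{S}\cup\{\mathrm{CNOT}\}\,\rangle_h .$$ -/

import Mathlib

noncomputable section

/-- The field of algebraic complex numbers. -/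
abbrev AlgComplex : Type := ↥(algebraicClosure ℚ ℂ)

/-- The functions from `{0,1}^k` to the algebraic complex numbers. -/
abbrev BoolFunOfArity (k : ℕ) : Type := (Fin k → Fin 2) → AlgComplex

/-- All algebraic-complex-valued functions of Boolean variables, of every arity `k ≥ 0`:
an element is a pair of an arity and a function of that arity. -/
abbrev BoolFun : Type := Σ k : ℕ, BoolFunOfArity k

/-- An atomic formula `g(v_{i_1}, …, v_{i_k})` over `F` in the variables `V`. The scope may
contain repeated variables. -/
structure AtomicFormula (F : Set BoolFun) (V : Type) where
  fn : BoolFun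
  fn_mem : fn ∈ F
  scope : Fin fn.1 → V

namespace AtomicFormula

variable {F : Set BoolFun} {V : Type}

/-- The value of an atomic formula under an assignment of the variables. -/
def eval (φ : AtomicFormula F V) (x : V → Fin 2) : AlgComplex :=
  φ.fn.2 fun i => x (φ.scope i)

/-- The number of times that a variable appears in the scope. -/
def multiplicity [DecidableEq V] (φ : AtomicFormula F V) (v : V) : ℕ :=
  (Finset.univ.filter fun i => φ.scope i = v).card

end AtomicFormula

/-- A primitive product summation formula over `F` with the `n` free variables `Sum.inl i`:
a number `numBound` of bound variables `Sum.inr i`, and a finite list of atomic formulas in the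
free and bound variables. -/
structure PPSFormula (F : Set BoolFun) (n : ℕ) where
  numBound : ℕ
  numAtoms : ℕ
  atom : Fin numAtoms → AtomicFormula F (Fin n ⊕ Fin numBound)

namespace PPSFormula

variable {F : Set BoolFun} {n : ℕ}

/-- The function represented by the formula: the sum over all assignments of the bound
variables of the product of the atomic formulas. -/
def eval (ψ : PPSFormula F n) : BoolFunOfArity n := fun x =>
  ∑ y : Fin ψ.numBound → Fin 2, ∏ j, (ψ.atom j).eval (Sum.elim x y)

/-- The total number of times that a variable appears in the scopes of the atomic formulas. -/
def multiplicity (ψ : PPSFormula F n) (v : Fin n ⊕ Fin ψ.numBound) : ℕ :=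
  ∑ j, (ψ.atom j).multiplicity v

/-- Every free variable appears exactly once, and every bound variable exactly twice. -/
def IsHolant (ψ : PPSFormula F n) : Prop :=
  (∀ i : Fin n, ψ.multiplicity (Sum.inl i) = 1) ∧
    ∀ i : Fin ψ.numBound, ψ.multiplicity (Sum.inr i) = 2

end PPSFormula

/-- The holant clone generated by `F`. -/
def holantClone (F : Set BoolFun) : Set BoolFun :=
  {f | ∃ ψ : PPSFormula F f.1, ψ.IsHolant ∧ ψ.eval = f.2}

/-- A function `f` of `2n` arguments is unitary if, for all `x, y ∈ {0,1}^n`, the sum over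
`z ∈ {0,1}^n` of `conj (f (x, z)) * f (y, z)` is `1` if `x = y` and `0` otherwise. -/
def IsUnitaryFun {n : ℕ} (f : BoolFunOfArity (n + n)) : Prop :=
  ∀ x y : Fin n → Fin 2,
    ∑ z : Fin n → Fin 2,
        (starRingEnd ℂ) (f (Fin.append x z) : ℂ) * (f (Fin.append y z) : ℂ) =
      ∏ j : Fin n, if x j = y j then 1 else 0

/-- The set of all unary functions. -/
def unaryFuns : Set BoolFun := {f | f.1 = 1}

/-- The set of all single-qubit gates: the binary unitary functions. -/
def singleQubitGates : Set BoolFun :=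
  {g | ∃ f : BoolFunOfArity (1 + 1), IsUnitaryFun f ∧ g = ⟨1 + 1, f⟩}

/-- The CNOT gate; the first two arguments are the inputs, the last two are the outputs. -/
def CNOT : BoolFun :=
  ⟨4, fun x =>
    if x = ![0, 0, 0, 0] ∨ x = ![0, 1, 0, 1] ∨ x = ![1, 0, 1, 1] ∨ x = ![1, 1, 1, 0]
    then 1 else 0⟩

end

/-! The unary functions and CNOT already suffice. Pinning one input of CNOT gives ternary equality,
and summing out another gives ternary addition mod 2; chaining these gives equalities and parity
constraints of every arity. Equalities copy variables, so the restriction on occurrences disappears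
(`comp`): products in shared variables (`prod`), sums (`sum`) and unary functions of parities
(`unary_sum`) are all available.

A nowhere vanishing function is a product of unary functions of parities: this is Fourier inversion
on the group of Boolean assignments in multiplicative form, where the division by the group order
becomes extraction of a root in an algebraically closed field (`exists_prod_zpow_fin_two_sign`). Any
`f` equals `c + (f - c)`, with both terms nowhere vanishing once `c` avoids 0 and the values of `f`.
-/

/-- `f` is represented by a holant formula over `F` whose free variables are indexed by `V`: the
occurrences of variables in the atoms are in bijection with the free variables and two copies of
the bound variables. -/
def IsRepresentable (F : Set BoolFun) {V : Type} (f : (V → Fin 2) → AlgComplex) : Prop :=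
  ∃ (B J : Type) (_ : Fintype B) (_ : DecidableEq B) (_ : Fintype J) (g : J → BoolFun)
    (e : (Σ j, Fin (g j).1) ≃ V ⊕ (B ⊕ B)), (∀ j, g j ∈ F) ∧
      ∀ x, f x = ∑ y : B → Fin 2, ∏ j, (g j).2 fun k => Sum.elim x (Sum.elim y y) (e ⟨j, k⟩)

/-! ### Tensor product and contraction of formulas -/

namespace IsRepresentable

variable {F : Set BoolFun} {V W U : Type}

theorem congr {f f' : (V → Fin 2) → AlgComplex} (hf : IsRepresentable F f)
    (h : ∀ x, f' x = f x) : IsRepresentable F f' := by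
  rwa [show f' = f from funext h]

theorem of_mem {g : BoolFun} (hg : g ∈ F) (e : Fin g.1 ≃ V) :
    IsRepresentable F fun x : V → Fin 2 => g.2 fun k => x (e k) := by
  refine ⟨Empty, Unit, inferInstance, inferInstance, inferInstance, fun _ => g,
    (Equiv.uniqueSigma fun _ : Unit => Fin g.1).trans (e.trans (Equiv.sumEmpty V _).symm),
    fun _ => hg, fun x => ?_⟩
  simp
  rfl

/-- Contraction of pairs of free variables, and renaming of the remaining ones. -/
theorem glue {f : (V → Fin 2) → AlgComplex} (hf : IsRepresentable F f) [Fintype U]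
    [DecidableEq U] (e : V ≃ W ⊕ (U ⊕ U)) :
    IsRepresentable F fun x : W → Fin 2 =>
      ∑ y : U → Fin 2, f fun v => Sum.elim x (Sum.elim y y) (e v) := by
  obtain ⟨B, J, _, _, _, g, e₀, hg, h⟩ := hf
  refine ⟨U ⊕ B, J, inferInstance, inferInstance, inferInstance, g,
    e₀.trans ((Equiv.sumCongr e (Equiv.refl _)).trans ((Equiv.sumAssoc _ _ _).trans
      (Equiv.sumCongr (Equiv.refl _) (Equiv.sumSumSumComm _ _ _ _)))), hg, fun x => ?_⟩
  rw [← (Equiv.sumArrowEquivProdArrow U B (Fin 2)).symm.sum_comp, Fintype.sum_prod_type]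
  refine Finset.sum_congr rfl fun y _ => ?_
  rw [h]
  refine Finset.sum_congr rfl fun z _ => Finset.prod_congr rfl fun j _ => ?_
  refine congrArg (g j).2 (funext fun k => ?_)
  simp only [Equiv.trans_apply]
  rcases e₀ ⟨j, k⟩ with v | b | b
  · simp only [Equiv.sumCongr_apply, Sum.map_inl, Sum.elim_inl]
    rcases e v with w | u | u <;> rfl
  · rfl
  · rfl

theorem reindex {f : (V → Fin 2) → AlgComplex} (hf : IsRepresentable F f) (e : V ≃ W) :
    IsRepresentable F fun x : W → Fin 2 => f fun v => x (e v) := by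
  refine (hf.glue (U := Empty) (e.trans (Equiv.sumEmpty W _).symm)).congr fun x => ?_
  simp

/-- The product of a family of representable functions in disjoint sets of variables. -/
theorem pi {I : Type} [Fintype I] [DecidableEq I] {V : I → Type}
    {f : ∀ i, (V i → Fin 2) → AlgComplex} (hf : ∀ i, IsRepresentable F (f i)) :
    IsRepresentable F fun x : (Σ i, V i) → Fin 2 => ∏ i, f i fun v => x ⟨i, v⟩ := by
  choose B J _ _ _ g e hg h using hf
  refine ⟨Σ i, B i, Σ i, J i, inferInstance, inferInstance, inferInstance, fun p => g p.1 p.2,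
    (Equiv.sigmaAssoc fun i j => Fin (g i j).1).trans ((Equiv.sigmaCongrRight e).trans
      ((Equiv.sigmaSumDistrib _ _).trans (Equiv.sumCongr (Equiv.refl _)
        (Equiv.sigmaSumDistrib _ _)))), fun p => hg p.1 p.2, fun x => ?_⟩
  rw [← (Equiv.piCurry fun (i : I) (_ : B i) => Fin 2).symm.sum_comp]
  simp only [h, Fintype.prod_sigma]
  rw [Finset.prod_univ_sum, Fintype.piFinset_univ]
  refine Finset.sum_congr rfl fun y _ => Finset.prod_congr rfl fun i _ =>
    Finset.prod_congr rfl fun j _ => ?_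
  refine congrArg (g i j).2 (funext fun k => ?_)
  simp only [Equiv.trans_apply]
  have : (Equiv.sigmaCongrRight e) ((Equiv.sigmaAssoc fun i j => Fin (g i j).1) ⟨⟨i, j⟩, k⟩) =
    ⟨i, e i ⟨j, k⟩⟩ := rfl
  rw [this]
  rcases e i ⟨j, k⟩ with v | b | b <;> rfl

/-- The product of two representable functions in disjoint sets of variables. -/
theorem tensor {f : (V → Fin 2) → AlgComplex} {g : (W → Fin 2) → AlgComplex}
    (hf : IsRepresentable F f) (hg : IsRepresentable F g) :
    IsRepresentable F fun x : V ⊕ W → Fin 2 =>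
      (f fun v => x (Sum.inl v)) * g fun w => x (Sum.inr w) := by
  have h := pi (F := F) (I := Bool) (V := fun b => bif b then W else V)
    (f := fun b => match b with
      | false => f
      | true => g) (by rintro (_ | _) <;> assumption)
  refine (h.reindex (Equiv.sumEquivSigmaBool V W).symm).congr fun x => ?_
  rw [Fintype.prod_bool, mul_comm]
  rfl

/-- Merging the two copies of the bound variables is a map `π` whose fibres have size one over free
variables and two over bound ones, which is the holant condition. -/
theorem mem_holantClone {n : ℕ} {f : BoolFunOfArity n} (hf : IsRepresentable F f) :
    (⟨n, f⟩ : BoolFun) ∈ holantClone F := by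
  obtain ⟨B, J, _, _, _, g, e, hg, h⟩ := hf
  let eB := Fintype.equivFin B
  let eJ := Fintype.equivFin J
  let π : Fin n ⊕ (B ⊕ B) → Fin n ⊕ Fin (Fintype.card B) := Sum.map id (Sum.elim eB eB)
  let ψ : PPSFormula F n :=
    ⟨Fintype.card B, Fintype.card J, fun j =>
      ⟨g (eJ.symm j), hg _, fun k => π (e ⟨eJ.symm j, k⟩)⟩⟩
  have hmul : ∀ v, ψ.multiplicity v = (Finset.univ.filter fun u => π u = v).card := by
    intro v
    calc ψ.multiplicity v
        = ∑ j, (Finset.univ.filter fun k : Fin (g j).1 => π (e ⟨j, k⟩) = v).card :=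
          eJ.symm.sum_comp fun j =>
            (Finset.univ.filter fun k : Fin (g j).1 => π (e ⟨j, k⟩) = v).card
      _ = _ := by
          simp only [Finset.card_filter]
          rw [← e.sum_comp, Fintype.sum_sigma]
  refine ⟨ψ, ⟨fun i => ?_, fun i => ?_⟩, funext fun x => ?_⟩
  · rw [hmul, Finset.card_eq_one]
    refine ⟨Sum.inl i, ?_⟩
    ext u
    rcases u with u | u | u <;> simp [π]
  · rw [hmul, Finset.card_eq_two]
    refine ⟨Sum.inr (Sum.inl (eB.symm i)), Sum.inr (Sum.inr (eB.symm i)), by simp, ?_⟩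
    ext u
    rcases u with u | u | u <;> simp [π, Equiv.eq_symm_apply]
  · refine Eq.trans ?_ (h x).symm
    change ∑ y : Fin (Fintype.card B) → Fin 2, ∏ j, (g (eJ.symm j)).2 (fun k =>
      Sum.elim x y (π (e ⟨eJ.symm j, k⟩))) = _
    rw [← (Equiv.arrowCongr eB (Equiv.refl (Fin 2))).sum_comp]
    refine Finset.sum_congr rfl fun y _ => ?_
    rw [← eJ.symm.prod_comp]
    refine Finset.prod_congr rfl fun j _ => ?_
    refine congrArg (g (eJ.symm j)).2 (funext fun k => ?_)
    rcases e ⟨eJ.symm j, k⟩ with v | b | b <;> simp [π]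

end IsRepresentable

/-! ### Gadgets from CNOT and unary functions -/

namespace IsRepresentable

variable {F : Set BoolFun} {V W U : Type}

/-- Contraction of the distinguished variable with the first variable of a ternary function. -/
theorem chain {f : (Option U → Fin 2) → AlgComplex} {g : (Fin 3 → Fin 2) → AlgComplex}
    (hf : IsRepresentable F f) (hg : IsRepresentable F g) :
    IsRepresentable F fun x : Option (Option U) → Fin 2 =>
      ∑ t : Fin 2, f (fun o => o.elim t fun u => x (some (some u))) *
        g ![t, x none, x (some none)] := by
  let e : Option U ⊕ Fin 3 ≃ Option (Option U) ⊕ (Unit ⊕ Unit) :=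
    { toFun := Sum.elim (fun o => o.elim (.inr (.inl ())) fun u => .inl (some (some u)))
        ![.inr (.inr ()), .inl none, .inl (some none)]
      invFun := Sum.elim
        (fun o => o.elim (.inr 1) fun o' => o'.elim (.inr 2) fun u => .inl (some u))
        (Sum.elim (fun _ => .inl none) fun _ => .inr 0)
      left_inv := by
        rintro ((_ | u) | i)
        · rfl
        · rfl
        · fin_cases i <;> rfl
      right_inv := by rintro ((_ | _ | u) | _ | _) <;> rfl }
  refine ((hf.tensor hg).glue e).congr fun x => ?_
  rw [← (Equiv.funUnique Unit (Fin 2)).symm.sum_comp]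
  refine Finset.sum_congr rfl fun t _ => ?_
  congr 2
  · funext o
    cases o <;> rfl
  · funext i
    fin_cases i <;> rfl

theorem one_of_isEmpty [IsEmpty V] : IsRepresentable F fun _ : V → Fin 2 => 1 :=
  ((pi (F := F) (I := Empty) (V := fun _ => Empty) (f := fun _ _ => 1) fun i => i.elim).reindex
    (Equiv.equivOfIsEmpty _ V)).congr fun x => by simp

theorem unary (hF : unaryFuns ⊆ F) [Unique V] (u : Fin 2 → AlgComplex) :
    IsRepresentable F fun x : V → Fin 2 => u (x default) :=
  (of_mem (g := ⟨1, fun x => u (x 0)⟩) (hF rfl)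
    (Equiv.ofUnique (Fin 1) V)).congr fun x => by congr 2

theorem cnot (hF : CNOT ∈ F) : IsRepresentable F fun x : Fin 4 → Fin 2 =>
    if x 2 = x 0 ∧ x 3 = x 1 + x 0 then 1 else 0 := by
  refine (of_mem hF (Equiv.refl (Fin 4))).congr fun x => ?_
  have h : ∀ x : Fin 4 → Fin 2, (x 2 = x 0 ∧ x 3 = x 1 + x 0) ↔
      (x = ![0, 0, 0, 0] ∨ x = ![0, 1, 0, 1] ∨ x = ![1, 0, 1, 1] ∨ x = ![1, 1, 1, 0]) := by
    decide
  change _ = (CNOT.2 x : AlgComplex)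
  simp only [CNOT, h]

/-- With the target input of CNOT pinned to 0 by `![1, 0]`, both outputs copy the control. -/
theorem eq_three (hF : unaryFuns ⊆ F) (hF' : CNOT ∈ F) :
    IsRepresentable F fun x : Fin 3 → Fin 2 => if x 1 = x 0 ∧ x 2 = x 0 then 1 else 0 := by
  let s : Fin 4 ⊕ Fin 1 → Fin 3 ⊕ (Unit ⊕ Unit) :=
    Sum.elim ![.inl 0, .inr (.inl ()), .inl 1, .inl 2] fun _ => .inr (.inr ())
  have hs : s.Bijective := by decide
  refine (((cnot hF').tensor (unary hF ![1, 0])).glue (Equiv.ofBijective s hs)).congr fun x => ?_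
  rw [← (Equiv.funUnique Unit (Fin 2)).symm.sum_comp]
  simp [s]

/-- The control input of CNOT is summed out against the constant 1; its copy among the outputs
survives as argument 0. The order of arguments suits `chain`: argument 0 is contracted and argument
1 becomes the new distinguished variable. -/
theorem add_three (hF : unaryFuns ⊆ F) (hF' : CNOT ∈ F) :
    IsRepresentable F fun x : Fin 3 → Fin 2 => if x 1 = x 2 + x 0 then 1 else 0 := by
  let s : Fin 4 ⊕ Fin 1 → Fin 3 ⊕ (Unit ⊕ Unit) :=
    Sum.elim ![.inr (.inl ()), .inl 2, .inl 0, .inl 1] fun _ => .inr (.inr ())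
  have hs : s.Bijective := by decide
  refine (((cnot hF').tensor (unary hF ![1, 1])).glue (Equiv.ofBijective s hs)).congr fun x => ?_
  rw [← (Equiv.funUnique Unit (Fin 2)).symm.sum_comp, Fin.sum_univ_two]
  simp only [s, Equiv.ofBijective_apply, Sum.elim_inl, Sum.elim_inr, Equiv.funUnique_symm_apply,
    uniqueElim_const, Matrix.cons_val]
  rcases Fin.exists_fin_two.1 ⟨x 0, rfl⟩ with h | h <;> simp [h]

open Classical in
/-- The equality of all variables. -/
theorem all_eq (hF : unaryFuns ⊆ F) (hF' : CNOT ∈ F) (U : Type) [Finite U] :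
    IsRepresentable F fun x : Option U → Fin 2 =>
      if ∀ u, x (some u) = x none then 1 else 0 := by
  induction U using Finite.induction_empty_option with
  | of_equiv e ih =>
    refine (ih.reindex (Equiv.optionCongr e)).congr fun x => if_congr ?_ rfl rfl
    exact e.forall_congr_right.symm
  | h_empty => exact (unary hF (V := Option PEmpty) fun _ => 1).congr fun x => by simp
  | h_option ih =>
    refine (ih.chain (eq_three hF hF')).congr fun x => ?_
    rw [Finset.sum_eq_single (x none) (fun t _ ht => by simp [ht.symm]) (by simp)]
    simp [Option.forall, ite_and]
    congr

/-- The indicator of the distinguished variable being the sum of the others. -/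
theorem eq_sum (hF : unaryFuns ⊆ F) (hF' : CNOT ∈ F) (U : Type) [Fintype U] :
    IsRepresentable F fun x : Option U → Fin 2 =>
      if x none = ∑ u, x (some u) then 1 else 0 := by
  -- The `Fintype` instance is quantified inside the statement because the induction is on `Finite`.
  suffices h : ∀ (U : Type) [Finite U], ∀ _ : Fintype U, IsRepresentable F
      fun x : Option U → Fin 2 => if x none = ∑ u, x (some u) then 1 else 0 from h U _
  intro U _
  induction U using Finite.induction_empty_option with
  | of_equiv e ih =>
    intro _
    refine ((ih (Fintype.ofEquiv _ e.symm)).reindex (Equiv.optionCongr e)).congr fun x =>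
      if_congr ?_ rfl rfl
    let := Fintype.ofEquiv _ e.symm
    rw [← e.sum_comp]
    rfl
  | h_empty =>
    intro _
    exact (unary hF (V := Option PEmpty) ![1, 0]).congr fun x => by
      rw [Subsingleton.elim default none]
      rcases Fin.exists_fin_two.1 ⟨x none, rfl⟩ with h | h <;> simp [h]
  | @h_option α _ ih =>
    intro h
    rw [Subsingleton.elim h instFintypeOption]
    refine ((ih inferInstance).chain (add_three hF hF')).congr fun x => ?_
    rw [Finset.sum_eq_single (∑ u, x (some (some u)))]
    · simp
      congr
    · intro t _ ht
      simp [ht]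
    · simp

/-- Substitution of variables along an arbitrary map. -/
theorem comp (hF : unaryFuns ⊆ F) (hF' : CNOT ∈ F) [Fintype V] [Fintype W]
    {f : (V → Fin 2) → AlgComplex} (hf : IsRepresentable F f) (p : V → W) :
    IsRepresentable F fun x : W → Fin 2 => f fun v => x (p v) := by
  classical
  -- Each `v` is contracted with its leg of the equality on the fibre over `p v`; the leg `none`
  -- stays free as `w`. Over an empty fibre the equality is the constant 1, so `w` is a dummy
  -- variable.
  let e : V ⊕ (Σ w, Option {v // p v = w}) ≃ W ⊕ (V ⊕ V) :=
    { toFun := Sum.elim (fun v => .inr (.inl v))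
        fun q => q.2.elim (.inl q.1) fun v => .inr (.inr v.1)
      invFun := Sum.elim (fun w => .inr ⟨w, none⟩)
        (Sum.elim .inl fun v => .inr ⟨p v, some ⟨v, rfl⟩⟩)
      left_inv := by rintro (v | ⟨w, _ | ⟨v, rfl⟩⟩) <;> rfl
      right_inv := by rintro (w | v | v) <;> rfl }
  refine ((hf.tensor (pi fun w => all_eq hF hF' {v // p v = w})).glue e).congr fun x => ?_
  rw [Finset.sum_eq_single fun v => x (p v)]
  · rw [Finset.prod_eq_one, mul_one]
    · rfl
    · rintro w -
      rw [if_pos]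
      rintro ⟨v, rfl⟩
      rfl
  · intro y _ hy
    obtain ⟨v, hv⟩ := Function.ne_iff.1 hy
    rw [Finset.prod_eq_zero (Finset.mem_univ (p v)), mul_zero]
    rw [if_neg]
    intro h
    exact hv (h ⟨v, rfl⟩)
  · simp

/-- The factors are first given disjoint copies of the variables, which are then identified by
`comp`. -/
theorem prod (hF : unaryFuns ⊆ F) (hF' : CNOT ∈ F) [Fintype V] {I : Type} [Fintype I]
    {f : I → (V → Fin 2) → AlgComplex} (hf : ∀ i, IsRepresentable F (f i)) :
    IsRepresentable F fun x => ∏ i, f i x := by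
  classical
  exact (pi hf).comp hF hF' Sigma.snd

/-- Contracting a variable with the constant 1 sums it out. -/
theorem sum (hF : unaryFuns ⊆ F) (hF' : CNOT ∈ F) [Fintype W] [DecidableEq W]
    {f : (V ⊕ W → Fin 2) → AlgComplex} (hf : IsRepresentable F f) :
    IsRepresentable F fun x : V → Fin 2 => ∑ y : W → Fin 2, f (Sum.elim x y) := by
  have h : IsRepresentable F fun _ : W → Fin 2 => 1 :=
    (one_of_isEmpty (V := Empty)).comp hF hF' Empty.elim
  refine ((hf.tensor h).glue (Equiv.sumAssoc V W W)).congr fun x =>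
    Finset.sum_congr rfl fun y _ => ?_
  rw [mul_one]
  congr 1
  funext v
  cases v <;> rfl

/-- A unary function of the sum of a set of variables. -/
theorem unary_sum (hF : unaryFuns ⊆ F) (hF' : CNOT ∈ F) [Fintype V] (u : Fin 2 → AlgComplex)
    (s : Finset V) : IsRepresentable F fun x : V → Fin 2 => u (∑ v ∈ s, x v) := by
  have h := ((eq_sum hF hF' s).tensor (unary hF (V := Unit) u)).glue (U := Unit) (W := s)
    { toFun := Sum.elim (fun o => o.elim (.inr (.inl ())) .inl) fun _ => .inr (.inr ())
      invFun := Sum.elim (fun w => .inl (some w)) (Sum.elim (fun _ => .inl none) .inr)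
      left_inv := by rintro ((_ | _) | _) <;> rfl
      right_inv := by rintro (_ | _ | _) <;> rfl }
  -- Substitution along the inclusion adds the variables outside `s` as dummies.
  refine (h.comp hF hF' Subtype.val).congr fun x => ?_
  rw [← (Equiv.funUnique Unit (Fin 2)).symm.sum_comp,
    Finset.sum_eq_single (∑ v ∈ s, x v)]
  · simp [Finset.sum_attach s x]
  · intro t _ ht
    simp [Finset.sum_attach s x, ht]
  · simp

end IsRepresentable

/-! ### Multiplicative Fourier inversion -/

theorem isAlgClosed_algComplex : IsAlgClosed AlgComplex := by
  have : IsAlgClosure ℚ AlgComplex := algebraicClosure.isAlgClosure ℚ ℂ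
  exact IsAlgClosure.isAlgClosed ℚ

/-- The nontrivial character of the group of order two. -/
def fin_two_sign (a : Fin 2) : ℤ := if a = 0 then 1 else -1

theorem fin_two_sign_add (a b : Fin 2) :
    fin_two_sign (a + b) = fin_two_sign a * fin_two_sign b := by
  revert a b
  decide

theorem fin_two_sign_sum {ι : Type*} (s : Finset ι) (x : ι → Fin 2) :
    fin_two_sign (∑ i ∈ s, x i) = ∏ i ∈ s, fin_two_sign (x i) := by
  classical
  induction s using Finset.induction_on with
  | empty => rfl
  | insert i s hi ih => rw [Finset.sum_insert hi, Finset.prod_insert hi, fin_two_sign_add, ih]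

/-- Orthogonality of the characters of a power of the group of order two. -/
theorem sum_fin_two_sign_mul {V : Type*} [Fintype V] (x y : V → Fin 2) :
    ∑ s : Finset V, fin_two_sign (∑ v ∈ s, y v) * fin_two_sign (∑ v ∈ s, x v) =
      if y = x then 2 ^ Fintype.card V else 0 := by
  have h : ∀ a b : Fin 2, 1 + fin_two_sign a * fin_two_sign b = if a = b then 2 else 0 := by
    decide
  simp_rw [fin_two_sign_sum, ← Finset.prod_mul_distrib]
  rw [← Finset.powerset_univ, ← Finset.prod_one_add]
  simp_rw [h]
  split_ifs with hxy
  · simp [hxy]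
  · obtain ⟨v, hv⟩ := Function.ne_iff.1 hxy
    exact Finset.prod_eq_zero (Finset.mem_univ v) (if_neg hv)

/-- Over an algebraically closed field, a nowhere vanishing function of Boolean variables is a
product of functions of parities. -/
theorem exists_prod_zpow_fin_two_sign {V K : Type*} [Fintype V] [Field K] [IsAlgClosed K]
    (f : (V → Fin 2) → K) (hf : ∀ x, f x ≠ 0) :
    ∃ c : Finset V → K, ∀ x, f x = ∏ s, c s ^ fin_two_sign (∑ v ∈ s, x v) := by
  classical
  -- Orthogonality will raise `r x` to the power `2 ^ Fintype.card V`, so a root of that order is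
  -- taken in advance. It is nonzero, as the exponents -1 require.
  choose r hr using fun x => IsAlgClosed.exists_pow_nat_eq (f x) (Nat.two_pow_pos (Fintype.card V))
  have hr0 : ∀ y, r y ≠ 0 := fun y h => hf y (by rw [← hr, h, zero_pow (by positivity)])
  refine ⟨fun s => ∏ y, r y ^ fin_two_sign (∑ v ∈ s, y v), fun x => ?_⟩
  have hsum : ∀ (t : Finset (Finset V)) (a : Finset V → ℤ) (y : V → Fin 2),
      ∏ s ∈ t, r y ^ a s = r y ^ ∑ s ∈ t, a s := by
    intro t a y
    induction t using Finset.induction_on with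
    | empty => simp
    | insert s t hs ih => rw [Finset.prod_insert hs, Finset.sum_insert hs, zpow_add₀ (hr0 y), ih]
  simp_rw [← Finset.prod_zpow, ← zpow_mul]
  rw [Finset.prod_comm]
  simp_rw [hsum, sum_fin_two_sign_mul]
  rw [Finset.prod_eq_single x (fun y _ hy => by simp [hy]) (by simp), if_pos rfl, ← hr x]
  exact_mod_cast rfl

/-! ### Universality -/

namespace IsRepresentable

variable {F : Set BoolFun} {V : Type}

theorem of_ne_zero (hF : unaryFuns ⊆ F) (hF' : CNOT ∈ F) [Fintype V]
    (f : (V → Fin 2) → AlgComplex) (hf : ∀ x, f x ≠ 0) : IsRepresentable F f := by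
  classical
  have := isAlgClosed_algComplex
  obtain ⟨c, hc⟩ := exists_prod_zpow_fin_two_sign f hf
  exact (prod hF hF' fun s => unary_sum hF hF' (fun a => c s ^ fin_two_sign a) s).congr hc

/-- Every function is representable over the unary functions and CNOT, being the sum of two nowhere
vanishing functions. -/
theorem of_unary_of_cnot (hF : unaryFuns ⊆ F) (hF' : CNOT ∈ F) [Fintype V]
    (f : (V → Fin 2) → AlgComplex) : IsRepresentable F f := by
  classical
  obtain ⟨c, hc⟩ := Infinite.exists_notMem_finset (insert 0 (Finset.univ.image f))
  simp only [Finset.mem_insert, Finset.mem_image, Finset.mem_univ, true_and, not_or,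
    not_exists] at hc
  -- An extra Boolean variable selects between `c` and `f - c`; summing over it gives `f`.
  refine (sum (V := V) (W := Unit) hF hF' (of_ne_zero hF hF' (fun x : V ⊕ Unit → Fin 2 =>
    if x (.inr ()) = 0 then c else f (fun v => x (.inl v)) - c) fun x => ?_)).congr fun x => ?_
  · split_ifs
    · exact hc.1
    · exact sub_ne_zero.2 (hc.2 _)
  · rw [← (Equiv.funUnique Unit (Fin 2)).symm.sum_comp]
    simp

end IsRepresentable

/-- Every algebraic-complex-valued function of Boolean variables lies in the holant clone
generated by the unary functions, the single-qubit gates and CNOT. -/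
theorem lemma5p20 :
    (Set.univ : Set BoolFun) ⊆ holantClone (unaryFuns ∪ singleQubitGates ∪ {CNOT}) := by
  rintro ⟨n, f⟩ -
  refine (IsRepresentable.of_unary_of_cnot ?_ ?_ f).mem_holantClone
  · exact fun g hg => Or.inl (Or.inl hg)
  · exact Or.inr rfl
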